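/- Let $\mathbb H=\mathbb R^3$ be the Heisenberg group with the group law $(x,y,z)(x',y',z')=\left(x+x',y+y',z+z'+\tfrac12(xy'-x'y)\right)$ and the orthonormal horizontal frame $X=\partial_x-\frac y2\partial_z$, $Y=\partial_y+\frac x2\partial_z$. The divergence of a horizontal vector field $\psi=\psi_1X+\psi_2Y$ is $\operatorname{div}\psi=X\psi_1+Y\psi_2$. For a measurable set $G\subset\mathbb H$ and an open set $U\subset\mathbb H$ put $$P(G;U)=\sup\Big\{\int_G(X\psi_1+Y\psi_2)\,d\mathcal L^3:\ \psi_1,\psi_2\in C^\infty_c(U),\ \psi_1^2+\psi_2^2\le1\Big\}.$$ We say that $G$ is a perimeter minimizer in $U$ if $P(G;U)\le P(F;U)$ for every measurable $F$ such that the closure of $(G\setminus F)\cup(F\setminus G)$ is compact and contained in $U$. A continuous horizontal vector field $\nu$ on $U$ is a calibration of $G$ in $U$ if $|\nu|=1$ on $U$, $\operatorname{div}\nu=0$ in $U$ in the sense of distributions, $G$ has locally finite perimeter in $U$, and $\nu$ coincides with the horizontal inward unit normal of $G$ almost everywhere in $U$ with respect to the perimeter measure of $G$. (The perimeter measure $\mu$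 and the inward normal $n$ are characterized by $\mu(V)=P(G;V)$ for $V\subset U$ open, $|n|=1$ $\mu$-a.e., and $\int_G\operatorname{div}\psi\,d\mathcal L^3=-\int_U\langle\psi,n\rangle\,d\mu$ for all smooth horizontal $\psi$ with compact support in $U$.) For $f:\mathbb R^2\to\mathbb R$ let $\Gamma_f=\{(0,y,t)(f(y,t),0,0):(y,t)\in\mathbb R^2\}$ be its intrinsic graph and $G_f=\{(0,y,t)(\xi,0,0):(y,t)\in\mathbb R^2,\ \xi\le f(y,t)\}$ its subgraph. Let $\Omega=\mathbb H\setminus\{x=y=0\}$ and $$\nu(x,y,z)=-\frac{y}{\sqrt{x^2+y^2}}X+\frac{x}{\sqrt{x^2+y^2}}Y,\qquad(x,y,z)\in\Omega.$$ Then $\nu$ is smooth and divergence free in $\Omega$, both pointwise and in the sense of distributions. Moreover, let $a:\mathbb R\to\mathbb R$ be continuous and non-decreasing and let $f:\mathbb R^2\to\mathbb R$ be the function with $$f\left(s,a(\tau)\tfrac{s^2}2+\tau\right)=a(\tau)s\qquad\text{for all }s,\tau\in\mathbb R.$$ Then $\nu$ is, up to orientation, a local calibration of $\Gamma_f$ in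 $\Omega$: every $p\in\Gamma_f\cap\Omega$ has an open neighbourhood $U\subset\Omega$ in which $\nu$ or $-\nu$ is a calibration of $G_f$. More precisely, $\nu$ is a calibration of $G_f$ in $\{y>0\}$ and $-\nu$ is a calibration of $G_f$ in $\{y<0\}$. Furthermore, $\Gamma_f$ is locally area minimizing outside the vertical axis: for every $p\in\Gamma_f\cap\Omega$ there is an open set $U\subset\Omega$ with $p\in U$ such that $P(G_f;U)<\infty$ and $G_f$ is a perimeter minimizer in $U$. -/

import Mathlib

open MeasureTheory
open scoped ContDiff

namespace Heisenberg

/-- The underlying manifold `ℝ³` of the first Heisenberg group, with points `(x, y, z)`,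
the product topology and the Lebesgue measure `volume`. -/
abbrev Pt : Type := ℝ × ℝ × ℝ

/-- The group law
`(x,y,z)(x',y',z') = (x + x', y + y', z + z' + (xy' - x'y)/2)`. -/
noncomputable def mul (p q : Pt) : Pt :=
  (p.1 + q.1, p.2.1 + q.2.1, p.2.2 + q.2.2 + (1 / 2) * (p.1 * q.2.1 - q.1 * p.2.1))

/-- The derivative along the left-invariant vector field `X = ∂_x - (y/2) ∂_z`. -/
noncomputable def X (φ : Pt → ℝ) (p : Pt) : ℝ :=
  fderiv ℝ φ p (1, 0, -(p.2.1 / 2))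

/-- The derivative along the left-invariant vector field `Y = ∂_y + (x/2) ∂_z`. -/
noncomputable def Y (φ : Pt → ℝ) (p : Pt) : ℝ :=
  fderiv ℝ φ p (0, 1, p.1 / 2)

/-- A horizontal vector field `ψ₁ X + ψ₂ Y`, given by its coefficients `(ψ₁, ψ₂)` in the
orthonormal horizontal frame `X, Y`. -/
abbrev HField : Type := Pt → ℝ × ℝ

/-- The square of the sub-Riemannian (Euclidean in the frame `X, Y`) length of a horizontal
vector. -/
def sqLen (v : ℝ × ℝ) : ℝ := v.1 ^ 2 + v.2 ^ 2

/-- The scalar product for which the frame `X, Y` is orthonormal. -/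
def dot (v w : ℝ × ℝ) : ℝ := v.1 * w.1 + v.2 * w.2

/-- The divergence `X ψ₁ + Y ψ₂` of the horizontal vector field `ψ₁ X + ψ₂ Y`. -/
noncomputable def hdiv (ψ : HField) (p : Pt) : ℝ :=
  X (fun q => (ψ q).1) p + Y (fun q => (ψ q).2) p

/-- Smooth horizontal vector fields with compact support in `U`. -/
def IsTestField (U : Set Pt) (ψ : HField) : Prop :=
  ContDiff ℝ ∞ ψ ∧ HasCompactSupport ψ ∧ tsupport ψ ⊆ U

/-- The sub-Riemannian perimeter `P_sR(G; U)` of `G` in the open set `U`. -/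
noncomputable def perimeter (G U : Set Pt) : ENNReal :=
  ⨆ (ψ : HField) (_ : IsTestField U ψ) (_ : ∀ p, sqLen (ψ p) ≤ 1),
    ENNReal.ofReal (∫ p in G, hdiv ψ p)

/-- `G` is a perimeter minimizer in the open set `U`: it does not have more perimeter in `U` than
any (Lebesgue) measurable competitor `F` whose symmetric difference with `G` is compactly
contained in `U`. -/
def IsPerimeterMinimizer (G U : Set Pt) : Prop :=
  NullMeasurableSet G volume ∧
  ∀ F : Set Pt, NullMeasurableSet F volume →
    IsCompact (closure ((G \ F) ∪ (F \ G))) → closure ((G \ F) ∪ (F \ G)) ⊆ U →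
    perimeter G U ≤ perimeter F U

/-- `E` has locally finite perimeter in the open set `U`, with perimeter measure `μ` (a measure
that is finite on compact subsets of `U`) and horizontal inward unit normal `n`: the
distributional horizontal gradient of the indicator function of `E` in `U` is `n μ`. -/
structure HasPerimeterNormal (E U : Set Pt) (μ : Measure Pt) (n : HField) : Prop where
  finite_compact : ∀ K : Set Pt, IsCompact K → K ⊆ U → μ K < ⊤
  measure_open : ∀ V : Set Pt, IsOpen V → V ⊆ U → μ V = perimeter E V
  aemeasurable : AEMeasurable n (μ.restrict U)
  unit : ∀ᵐ p ∂(μ.restrict U), sqLen (n p) = 1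
  gauss_green : ∀ ψ : HField, IsTestField U ψ →
    ∫ p in E, hdiv ψ p = -∫ p in U, dot (ψ p) (n p) ∂μ

/-- The distributional divergence of the (locally integrable) horizontal vector field `ν`
vanishes in the open set `U`. -/
def IsDivFreeOn (ν : HField) (U : Set Pt) : Prop :=
  LocallyIntegrableOn ν U volume ∧
  ∀ φ : Pt → ℝ, ContDiff ℝ ∞ φ → HasCompactSupport φ → tsupport φ ⊆ U →
    ∫ p in U, ((ν p).1 * X φ p + (ν p).2 * Y φ p) = 0

/-- `ν` is a calibration in the open set `U` of (the boundary of) `E`: it is a continuous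
horizontal unit vector field on `U` with vanishing divergence, and it agrees almost everywhere
for the perimeter measure of `E` in `U` with the horizontal inward normal of `E`. -/
def IsCalibration (ν : HField) (E U : Set Pt) : Prop :=
  ContinuousOn ν U ∧ (∀ p ∈ U, sqLen (ν p) = 1) ∧ IsDivFreeOn ν U ∧
  NullMeasurableSet E volume ∧
  ∃ (μ : Measure Pt) (n : HField), HasPerimeterNormal E U μ n ∧ n =ᵐ[μ.restrict U] ν

/-- The intrinsic graph `Γ_f = {(0,y,t)(f(y,t),0,0)}` of `f`. -/
def intrinsicGraph (f : ℝ × ℝ → ℝ) : Set Pt :=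
  {p | ∃ y t : ℝ, p = mul (0, y, t) (f (y, t), 0, 0)}

/-- The subgraph `G_f = {(0,y,t)(ξ,0,0) : ξ ≤ f(y,t)}` of `f`. -/
def subgraph (f : ℝ × ℝ → ℝ) : Set Pt :=
  {p | ∃ y t ξ : ℝ, ξ ≤ f (y, t) ∧ p = mul (0, y, t) (ξ, 0, 0)}

/-- The complement of the vertical axis `{x = y = 0}`. -/
def offAxis : Set Pt := {p | ¬ (p.1 = 0 ∧ p.2.1 = 0)}

/-- The horizontal vector field `ν = (-y X + x Y) / √(x² + y²)`. -/
noncomputable def nu : HField := fun p =>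
  (-(p.2.1) / Real.sqrt (p.1 ^ 2 + p.2.1 ^ 2), p.1 / Real.sqrt (p.1 ^ 2 + p.2.1 ^ 2))

/-- `Γ_f` is the graphical strip with slope function `a`: `a` is continuous and non-decreasing
and `f(s, a(τ) s²/2 + τ) = a(τ) s` for all `s, τ`. (The map `(s, τ) ↦ (s, a(τ) s²/2 + τ)` is a
bijection of the plane, so that this equation determines `f`.) -/
def IsGraphicalStrip (a : ℝ → ℝ) (f : ℝ × ℝ → ℝ) : Prop :=
  Continuous a ∧ Monotone a ∧ ∀ s τ : ℝ, f (s, a τ * (s ^ 2 / 2) + τ) = a τ * s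

end Heisenberg

namespace Heisenberg

open Set Filter Topology

/-! In the coordinates `(x, y, z)` the subgraph is the set `x ≤ a(z) y`: the slice of the surface at
height `z` is the horizontal line of slope `a(z)` through the axis (`IsGraphicalStrip.subgraph_eq`).
Hence the horizontal normal is orthogonal to the radial direction. It is `ν` or `-ν` according to
the sign of `y`, and no longer depends on `a`. The field `ν` is the rotation field times a radial
function, so it is divergence free (`hdiv_nu`).

As `a` is only continuous, the Gauss–Green formula is proved direction by direction. The divergence
is `∂_x ψ₁ + ∂_y ψ₂ + ∂_z (x ψ₂ - y ψ₁) / 2`. The first two terms are integrated with `z` frozen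
(`setIntegral_partial_x`, `setIntegral_partial_y`). The last is integrated along vertical lines,
where monotonicity of `a` makes `{z | x / y ≤ a z}` a half-line, everything or nothing
(`setIntegral_partial_z`). Both boundary terms pair `ψ` with `±ν` against a positive measure
(`smoothNormal_subgraph`), and the sum of the two measures is the perimeter measure.

The rest is the calibration argument of `SmoothNormal`. Cauchy–Schwarz bounds the perimeter by `μ`;
a cutoff of `-n` shows equality. Where the cutoff is one its divergence vanishes, so its flux does
not distinguish `G` from a competitor. -/

/-! ### Calculus of horizontal fields and cutoffs. -/

lemma hdiv_congr {ψ ψ' : HField} {p : Pt} (h : ψ =ᶠ[𝓝 p] ψ') : hdiv ψ p = hdiv ψ' p := by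
  have h1 : (fun q => (ψ q).1) =ᶠ[𝓝 p] fun q => (ψ' q).1 := h.fun_comp Prod.fst
  have h2 : (fun q => (ψ q).2) =ᶠ[𝓝 p] fun q => (ψ' q).2 := h.fun_comp Prod.snd
  simp only [hdiv, X, Y, h1.fderiv_eq, h2.fderiv_eq]

lemma hdiv_neg (ψ : HField) (p : Pt) : hdiv (-ψ) p = -hdiv ψ p := by
  have h1 : (fun q => ((-ψ) q).1) = -fun q => (ψ q).1 := rfl
  have h2 : (fun q => ((-ψ) q).2) = -fun q => (ψ q).2 := rfl
  simp only [hdiv, X, Y, h1, h2, fderiv_neg, neg_apply]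
  ring

lemma hdiv_smul {χ : Pt → ℝ} {n : HField} {p : Pt} (hχ : DifferentiableAt ℝ χ p)
    (hn : DifferentiableAt ℝ n p) :
    hdiv (fun q => χ q • n q) p =
      χ p * hdiv n p + ((n p).1 * X χ p + (n p).2 * Y χ p) := by
  have h1 : fderiv ℝ (fun q => χ q * (n q).1) p = _ := fderiv_fun_mul hχ hn.fst
  have h2 : fderiv ℝ (fun q => χ q * (n q).2) p = _ := fderiv_fun_mul hχ hn.snd
  simp only [hdiv, X, Y, Prod.smul_fst, Prod.smul_snd, smul_eq_mul, h1, h2,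
    add_apply, smul_apply]
  ring

lemma hdiv_eq_zero_of_notMem_tsupport {ψ : HField} {p : Pt} (hp : p ∉ tsupport ψ) :
    hdiv ψ p = 0 := by
  rw [hdiv_congr (notMem_tsupport_iff_eventuallyEq.1 hp)]
  simp [hdiv, X, Y]

/-- The field `n` may be singular outside `U`, as `ν` is on the axis; near such points `χ` vanishes
identically. -/
lemma contDiff_smul_of_tsupport_subset {χ : Pt → ℝ} {n : HField} {U : Set Pt} (hU : IsOpen U)
    (hχ : ContDiff ℝ ∞ χ) (hs : tsupport χ ⊆ U) (hn : ContDiffOn ℝ ∞ n U) :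
    ContDiff ℝ ∞ (fun p => χ p • n p) := by
  rw [contDiff_iff_contDiffAt]
  intro p
  by_cases hp : p ∈ tsupport χ
  · exact hχ.contDiffAt.smul (hn.contDiffAt (hU.mem_nhds (hs hp)))
  · have : (fun p => χ p • n p) =ᶠ[𝓝 p] fun _ => 0 := by
      filter_upwards [notMem_tsupport_iff_eventuallyEq.1 hp] with q hq
      simp [hq]
    exact contDiffAt_const.congr_of_eventuallyEq this

lemma isTestField_smul {χ : Pt → ℝ} {n : HField} {U V : Set Pt} (hU : IsOpen U)
    (hVU : V ⊆ U) (hχ : ContDiff ℝ ∞ χ) (hc : HasCompactSupport χ) (hs : tsupport χ ⊆ V)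
    (hn : ContDiffOn ℝ ∞ n U) : IsTestField V (fun p => χ p • n p) :=
  ⟨contDiff_smul_of_tsupport_subset hU hχ (hs.trans hVU) hn, hc.smul_right,
    (tsupport_smul_subset_left χ n).trans hs⟩

/-- A smooth cutoff function which is one near `K` and is supported in `V`. -/
lemma exists_cutoff {K V : Set Pt} (hK : IsCompact K) (hV : IsOpen V) (hKV : K ⊆ V) :
    ∃ χ : Pt → ℝ, ContDiff ℝ ∞ χ ∧ HasCompactSupport χ ∧ tsupport χ ⊆ V ∧
      (∀ p ∈ K, χ =ᶠ[𝓝 p] 1) ∧ ∀ p, χ p ∈ Icc 0 1 := by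
  obtain ⟨L, hL, hKL, hLV⟩ := exists_compact_between hK hV hKV
  obtain ⟨χ, h1, h0, h01⟩ := exists_contMDiffMap_one_nhds_of_subset_interior (n := ⊤)
    (modelWithCornersSelf ℝ Pt) hK.isClosed hKL
  have hsub : tsupport χ ⊆ L := closure_minimal (fun p hp => by
    by_contra hpL
    exact hp (h0 p hpL)) hL.isClosed
  refine ⟨χ, χ.contMDiff.contDiff, hL.of_isClosed_subset (isClosed_tsupport _) hsub,
    hsub.trans hLV, fun p hp => ?_, h01⟩
  exact (eventually_nhdsSet_iff_forall.1 h1) p hp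

lemma le_perimeter {G V : Set Pt} {ψ : HField} (hψ : IsTestField V ψ)
    (hψ1 : ∀ p, sqLen (ψ p) ≤ 1) : ENNReal.ofReal (∫ p in G, hdiv ψ p) ≤ perimeter G V :=
  le_iSup_of_le ψ (le_iSup_of_le hψ (le_iSup (fun _ : ∀ p, sqLen (ψ p) ≤ 1 =>
    ENNReal.ofReal (∫ p in G, hdiv ψ p)) hψ1))

lemma abs_dot_le_one {v w : ℝ × ℝ} (hv : sqLen v ≤ 1) (hw : sqLen w = 1) : |dot v w| ≤ 1 := by
  rw [abs_le]
  unfold sqLen at hv hw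
  unfold dot
  constructor
  · nlinarith [sq_nonneg (v.1 + w.1), sq_nonneg (v.2 + w.2)]
  · nlinarith [sq_nonneg (v.1 - w.1), sq_nonneg (v.2 - w.2)]

/-! ### The calibration argument. -/

/-- The data of a set `G` with a smooth divergence free unit field `n` on `U`, which satisfies the
Gauss--Green formula for `G` with a measure `μ`. -/
structure SmoothNormal (G U : Set Pt) (μ : Measure Pt) (n : HField) : Prop where
  isOpen : IsOpen U
  contDiffOn : ContDiffOn ℝ ∞ n U
  unit : ∀ p ∈ U, sqLen (n p) = 1
  hdiv_eq_zero : ∀ p ∈ U, hdiv n p = 0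
  nullMeasurable : NullMeasurableSet G volume
  finite_compact : ∀ K : Set Pt, IsCompact K → K ⊆ U → μ K < ⊤
  gauss_green : ∀ ψ : HField, IsTestField U ψ →
    ∫ p in G, hdiv ψ p = -∫ p in U, dot (ψ p) (n p) ∂μ

namespace SmoothNormal

variable {G U V : Set Pt} {μ : Measure Pt} {n : HField}

/-- Cauchy–Schwarz in the Gauss–Green formula bounds the flux of a test field by the mass of its
support. -/
lemma perimeter_le (h : SmoothNormal G U μ n) (hVU : V ⊆ U) : perimeter G V ≤ μ V := by
  refine iSup_le fun ψ => iSup_le fun hψ => iSup_le fun hψ1 => ?_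
  obtain ⟨hs, hc, hsub⟩ := hψ
  have hK : μ (tsupport ψ) < ⊤ := h.finite_compact _ hc (hsub.trans hVU)
  have hUK : tsupport ψ ⊆ U := hsub.trans hVU
  have hres : ∫ p in U, dot (ψ p) (n p) ∂μ = ∫ p in tsupport ψ, dot (ψ p) (n p) ∂μ := by
    refine setIntegral_eq_of_subset_of_forall_sdiff_eq_zero h.isOpen.measurableSet hUK ?_
    intro p hp
    simp [dot, image_eq_zero_of_notMem_tsupport hp.2]
  have hb : ‖∫ p in tsupport ψ, dot (ψ p) (n p) ∂μ‖ ≤ 1 * μ.real (tsupport ψ) :=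
    norm_setIntegral_le_of_norm_le_const hK fun p hp =>
      abs_dot_le_one (hψ1 p) (h.unit p (hUK hp))
  rw [h.gauss_green ψ ⟨hs, hc, hUK⟩, hres]
  calc ENNReal.ofReal (-∫ p in tsupport ψ, dot (ψ p) (n p) ∂μ)
      ≤ ENNReal.ofReal (μ.real (tsupport ψ)) := by
        refine ENNReal.ofReal_le_ofReal ?_
        rw [one_mul, Real.norm_eq_abs] at hb
        exact (neg_le_abs _).trans hb
    _ = μ (tsupport ψ) := ENNReal.ofReal_toReal hK.ne
    _ ≤ μ V := measure_mono hsub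

/-- The measure of a compact set is bounded by the flux of a test field that is divergence free
there. -/
lemma exists_testField (h : SmoothNormal G U μ n) (hV : IsOpen V) (hVU : V ⊆ U) {K : Set Pt}
    (hK : IsCompact K) (hKV : K ⊆ V) :
    ∃ ψ : HField, IsTestField V ψ ∧ (∀ p, sqLen (ψ p) ≤ 1) ∧ (∀ p ∈ K, hdiv ψ p = 0) ∧
      μ K ≤ ENNReal.ofReal (∫ p in G, hdiv ψ p) := by
  obtain ⟨χ, hχ, hc, hs, h1, h01⟩ := exists_cutoff hK hV hKV
  -- The sign compensates the inward normal: the flux of `-χ n` is `∫ χ dμ`, which is at least `μ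
  -- K`.
  have hm : ContDiffOn ℝ ∞ (-n) U := h.contDiffOn.neg
  have hψ : IsTestField V (fun p => χ p • (-n) p) := isTestField_smul h.isOpen hVU hχ hc hs hm
  refine ⟨fun p => χ p • (-n) p, hψ, fun p => ?_, fun p hp => ?_, ?_⟩
  · by_cases hp : p ∈ tsupport χ
    · have hu := h.unit p (hVU (hs hp))
      have hx : sqLen (χ p • (-n) p) = χ p ^ 2 * sqLen (n p) := by simp [sqLen]; ring
      rw [hx, hu, mul_one]
      exact pow_le_one₀ (h01 p).1 (h01 p).2
    · simp [image_eq_zero_of_notMem_tsupport hp, sqLen]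
  · have : (fun p => χ p • (-n) p) =ᶠ[𝓝 p] -n := by
      filter_upwards [h1 p hp] with q hq
      simp [hq]
    rw [hdiv_congr this, hdiv_neg, h.hdiv_eq_zero p (hVU (hKV hp)), neg_zero]
  · have hKtop : μ K < ⊤ := h.finite_compact K hK (hKV.trans hVU)
    have hStop : μ (tsupport χ) < ⊤ := h.finite_compact _ hc (hs.trans hVU)
    have hKs : K ⊆ tsupport χ := fun p hp => subset_tsupport _ (by
      simp [(h1 p hp).eq_of_nhds])
    rw [h.gauss_green _ ⟨hψ.1, hψ.2.1, hψ.2.2.trans hVU⟩, ← integral_neg]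
    have hE : ∫ p in U, -dot (χ p • (-n) p) (n p) ∂μ = ∫ p in U, χ p ∂μ := by
      refine setIntegral_congr_fun h.isOpen.measurableSet fun p hp => ?_
      have hu := h.unit p hp
      simp only [dot, sqLen, Prod.smul_fst, Prod.smul_snd, smul_eq_mul, Pi.neg_apply,
        Prod.fst_neg, Prod.snd_neg] at hu ⊢
      linear_combination χ p * hu
    have hE2 : ∫ p in U, χ p ∂μ = ∫ p in tsupport χ, χ p ∂μ :=
      setIntegral_eq_of_subset_of_forall_sdiff_eq_zero h.isOpen.measurableSet (hs.trans hVU)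
        fun p hp => image_eq_zero_of_notMem_tsupport hp.2
    have hint : IntegrableOn χ (tsupport χ) μ := by
      refine Measure.integrableOn_of_bounded (M := 1) hStop.ne
        hχ.continuous.aestronglyMeasurable (Eventually.of_forall fun p => ?_)
      rw [Real.norm_eq_abs, abs_of_nonneg (h01 p).1]
      exact (h01 p).2
    have hle : μ.real K ≤ ∫ p in tsupport χ, χ p ∂μ := by
      calc μ.real K = ∫ p in K, χ p ∂μ := by
            rw [setIntegral_congr_fun (g := fun _ => (1 : ℝ)) hK.measurableSet
              fun p hp => (h1 p hp).eq_of_nhds]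
            simp
        _ ≤ ∫ p in tsupport χ, χ p ∂μ :=
            setIntegral_mono_set hint (Eventually.of_forall fun p => (h01 p).1)
              hKs.eventuallyLE
    rw [hE, hE2, ← ENNReal.ofReal_toReal hKtop.ne]
    exact ENNReal.ofReal_le_ofReal hle

/-- An open set is an increasing union of compact sets: closed sets cut by balls. No regularity of
`μ` is required. -/
lemma measure_le_of_forall_compact (hV : IsOpen V) {c : ENNReal}
    (hc : ∀ K, IsCompact K → K ⊆ V → μ K ≤ c) : μ V ≤ c := by
  obtain ⟨F, hF, hFV, hFU, hmono⟩ := hV.exists_iUnion_isClosed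
  have hU : V = ⋃ k : ℕ, F k ∩ Metric.closedBall 0 k := by
    have hball : Monotone fun k : ℕ => Metric.closedBall (0 : Pt) k := fun i j hij =>
      Metric.closedBall_subset_closedBall (by exact_mod_cast hij)
    rw [iUnion_inter_of_monotone hmono hball, Metric.iUnion_closedBall_nat, inter_univ, hFU]
  rw [hU, Monotone.measure_iUnion]
  · exact iSup_le fun k => hc _ ((isCompact_closedBall _ _).inter_left (hF k))
      (inter_subset_left.trans (hFV k))
  · exact fun i j hij => inter_subset_inter (hmono hij)
      (Metric.closedBall_subset_closedBall (by exact_mod_cast hij))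

lemma measure_eq_perimeter (h : SmoothNormal G U μ n) (hV : IsOpen V) (hVU : V ⊆ U) :
    μ V = perimeter G V := by
  refine le_antisymm (measure_le_of_forall_compact hV fun K hK hKV => ?_) (h.perimeter_le hVU)
  obtain ⟨ψ, hψ, hψ1, -, hle⟩ := h.exists_testField hV hVU hK hKV
  exact hle.trans (le_perimeter hψ hψ1)

lemma hasPerimeterNormal (h : SmoothNormal G U μ n) : HasPerimeterNormal G U μ n where
  finite_compact := h.finite_compact
  measure_open _ hV hVU := h.measure_eq_perimeter hV hVU
  aemeasurable := h.contDiffOn.continuousOn.aemeasurable h.isOpen.measurableSet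
  unit := (ae_restrict_iff' h.isOpen.measurableSet).2 (Eventually.of_forall h.unit)
  gauss_green := h.gauss_green

/-- A set with a smooth divergence free extension of its normal is a perimeter minimizer. -/
lemma isPerimeterMinimizer (h : SmoothNormal G U μ n) (hV : IsOpen V) (hVU : V ⊆ U) :
    IsPerimeterMinimizer G V := by
  refine ⟨h.nullMeasurable, fun F hF hc hsub => ?_⟩
  rw [← h.measure_eq_perimeter hV hVU]
  refine measure_le_of_forall_compact hV fun K hK hKV => ?_
  -- Adding the closed symmetric difference to `K` makes the divergence of `ψ` vanish wherever `F`
  -- and `G` differ.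
  obtain ⟨ψ, hψ, hψ1, h0, hle⟩ := h.exists_testField hV hVU (hK.union hc)
    (union_subset hKV hsub)
  have hFG : ∫ p in G, hdiv ψ p = ∫ p in F, hdiv ψ p := by
    rw [← integral_indicator₀ h.nullMeasurable, ← integral_indicator₀ hF]
    congr 1
    ext p
    by_cases hp : p ∈ (G \ F) ∪ (F \ G)
    · have := h0 p (Or.inr (subset_closure hp))
      simp only [indicator, this, ite_self]
    · have : p ∈ G ↔ p ∈ F := by
        simp only [mem_union, Set.mem_sdiff] at hp
        tauto
      by_cases hpF : p ∈ F
      · rw [indicator_of_mem (this.2 hpF), indicator_of_mem hpF]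
      · rw [indicator_of_notMem (mt this.1 hpF), indicator_of_notMem hpF]
  calc μ K ≤ μ (K ∪ closure ((G \ F) ∪ (F \ G))) := measure_mono subset_union_left
    _ ≤ _ := hle
    _ = ENNReal.ofReal (∫ p in F, hdiv ψ p) := by rw [hFG]
    _ ≤ perimeter F V := le_perimeter hψ hψ1

end SmoothNormal

/-! ### Reduction to Euclidean partial derivatives. -/

instance : (volume : Measure (ℝ × ℝ)).IsAddHaarMeasure :=
  inferInstanceAs ((volume : Measure ℝ).prod (volume : Measure ℝ)).IsAddHaarMeasure

instance : (volume : Measure Pt).IsAddHaarMeasure :=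
  inferInstanceAs ((volume : Measure ℝ).prod (volume : Measure (ℝ × ℝ))).IsAddHaarMeasure

lemma integrable_fderiv_apply {φ : Pt → ℝ} (hφ : ContDiff ℝ ∞ φ) (hc : HasCompactSupport φ)
    (v : Pt) : Integrable (fun p => fderiv ℝ φ p v) :=
  ((hφ.continuous_fderiv (by simp)).clm_apply continuous_const).integrable_of_hasCompactSupport
    (hc.fderiv_apply ℝ v)

lemma integral_fderiv_apply_eq_zero {φ : Pt → ℝ} (hφ : ContDiff ℝ ∞ φ)
    (hc : HasCompactSupport φ) (v : Pt) : ∫ p, fderiv ℝ φ p v = 0 := by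
  -- Integration by parts against the constant one.
  have := integral_mul_fderiv_eq_neg_fderiv_mul_of_integrable (μ := (volume : Measure Pt))
    (f := fun _ : Pt => (1 : ℝ)) (g := φ) (v := v) (by simp) (by simpa using integrable_fderiv_apply hφ hc v)
    (by simpa using hφ.continuous.integrable_of_hasCompactSupport hc)
    (fun x _ => by fun_prop) (fun x _ => hφ.differentiable (by simp) x)
  simpa using this

/-- The coefficient `y / 2` does not depend on `z`, so it can be moved inside `∂_z`. -/
lemma X_eq_sub {φ : Pt → ℝ} {p : Pt} (hφ : DifferentiableAt ℝ φ p) :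
    X φ p = fderiv ℝ φ p (1, 0, 0) - fderiv ℝ (fun q => q.2.1 / 2 * φ q) p (0, 0, 1) := by
  have h1 : HasFDerivAt (fun q : Pt => q.2.1 / 2)
      ((2⁻¹ : ℝ) • (ContinuousLinearMap.fst ℝ ℝ ℝ ∘L ContinuousLinearMap.snd ℝ ℝ (ℝ × ℝ))) p := by
    convert! ((ContinuousLinearMap.fst ℝ ℝ ℝ ∘L
      ContinuousLinearMap.snd ℝ ℝ (ℝ × ℝ)).hasFDerivAt (x := p)).const_mul (2⁻¹ : ℝ) using 1
    ext q
    simp; ring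
  have hv : ((1, 0, -(p.2.1 / 2)) : Pt) = (1, 0, 0) - (p.2.1 / 2) • (0, 0, 1) := by simp
  rw [(h1.fun_mul hφ.hasFDerivAt).fderiv, X, hv, map_sub, map_smul]
  simp

lemma Y_eq_add {φ : Pt → ℝ} {p : Pt} (hφ : DifferentiableAt ℝ φ p) :
    Y φ p = fderiv ℝ φ p (0, 1, 0) + fderiv ℝ (fun q => q.1 / 2 * φ q) p (0, 0, 1) := by
  have h1 : HasFDerivAt (fun q : Pt => q.1 / 2)
      ((2⁻¹ : ℝ) • (ContinuousLinearMap.fst ℝ ℝ (ℝ × ℝ))) p := by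
    convert! ((ContinuousLinearMap.fst ℝ ℝ (ℝ × ℝ)).hasFDerivAt (x := p)).const_mul
      (2⁻¹ : ℝ) using 1
    ext q
    simp; ring
  have hv : ((0, 1, p.1 / 2) : Pt) = (0, 1, 0) + (p.1 / 2) • (0, 0, 1) := by simp
  rw [(h1.fun_mul hφ.hasFDerivAt).fderiv, Y, hv, map_add, map_smul]
  simp

/-- The integral of the divergence as a sum of integrals of partial derivatives. -/
lemma setIntegral_hdiv {ψ : HField} (hψ : ContDiff ℝ ∞ ψ) (hc : HasCompactSupport ψ)
    (G : Set Pt) :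
    ∫ p in G, hdiv ψ p =
      (∫ p in G, fderiv ℝ (fun q => (ψ q).1) p (1, 0, 0)) +
      (∫ p in G, fderiv ℝ (fun q => (ψ q).2) p (0, 1, 0)) +
      ∫ p in G, fderiv ℝ (fun q => q.1 / 2 * (ψ q).2 - q.2.1 / 2 * (ψ q).1) p (0, 0, 1) := by
  have h1 : ContDiff ℝ ∞ fun q => (ψ q).1 := hψ.fst
  have h2 : ContDiff ℝ ∞ fun q => (ψ q).2 := hψ.snd
  have c1 : HasCompactSupport fun q => (ψ q).1 := hc.comp_left (g := Prod.fst) rfl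
  have c2 : HasCompactSupport fun q => (ψ q).2 := hc.comp_left (g := Prod.snd) rfl
  have h3 : ContDiff ℝ ∞ fun q : Pt => q.2.1 / 2 * (ψ q).1 := (contDiff_snd.fst.div_const 2).mul h1
  have h4 : ContDiff ℝ ∞ fun q : Pt => q.1 / 2 * (ψ q).2 := (contDiff_fst.div_const 2).mul h2
  have c3 : HasCompactSupport fun q : Pt => q.2.1 / 2 * (ψ q).1 := c1.mul_left
  have c4 : HasCompactSupport fun q : Pt => q.1 / 2 * (ψ q).2 := c2.mul_left
  have c5 := c4.sub c3
  have i1 := (integrable_fderiv_apply h1 c1 (1, 0, 0)).integrableOn (s := G)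
  have i2 := (integrable_fderiv_apply h2 c2 (0, 1, 0)).integrableOn (s := G)
  have i5 := (integrable_fderiv_apply (h4.sub h3) c5 (0, 0, 1)).integrableOn (s := G)
  rw [← integral_add i1 i2, ← integral_add (by exact i1.add i2) i5]
  congr 1
  ext p
  have d1 := h1.differentiable (by simp) p
  have d2 := h2.differentiable (by simp) p
  have d3 := h3.differentiable (by simp) p
  have d4 := h4.differentiable (by simp) p
  have : fderiv ℝ (fun q => q.1 / 2 * (ψ q).2 - q.2.1 / 2 * (ψ q).1) p = _ :=
    fderiv_fun_sub d4 d3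
  rw [hdiv, X_eq_sub d1, Y_eq_add d2, this, sub_apply]
  ring

lemma integral_hdiv_eq_zero {ψ : HField} (hψ : ContDiff ℝ ∞ ψ) (hc : HasCompactSupport ψ) :
    ∫ p, hdiv ψ p = 0 := by
  have c1 : HasCompactSupport fun q => (ψ q).1 := hc.comp_left (g := Prod.fst) rfl
  have c2 : HasCompactSupport fun q => (ψ q).2 := hc.comp_left (g := Prod.snd) rfl
  have c5 : HasCompactSupport fun q : Pt => q.1 / 2 * (ψ q).2 - q.2.1 / 2 * (ψ q).1 :=
    (c2.mul_left (f := fun q : Pt => q.1 / 2)).sub (c1.mul_left (f := fun q : Pt => q.2.1 / 2))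
  have := setIntegral_hdiv hψ hc univ
  simp only [Measure.restrict_univ] at this
  rw [this, integral_fderiv_apply_eq_zero hψ.fst c1, integral_fderiv_apply_eq_zero hψ.snd c2,
    integral_fderiv_apply_eq_zero (((contDiff_fst.div_const 2).mul hψ.snd).sub
      ((contDiff_snd.fst.div_const 2).mul hψ.fst)) c5]
  simp

/-- A smooth field whose divergence vanishes pointwise is divergence free in the sense of
distributions. -/
lemma isDivFreeOn_of_hdiv_eq_zero {n : HField} {U : Set Pt} (hU : IsOpen U)
    (hn : ContDiffOn ℝ ∞ n U) (h0 : ∀ p ∈ U, hdiv n p = 0) : IsDivFreeOn n U := by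
  refine ⟨hn.continuousOn.locallyIntegrableOn hU.measurableSet, fun φ hφ hc hs => ?_⟩
  have hψ := isTestField_smul hU subset_rfl hφ hc hs hn
  -- The field `φ n` is a global test field, so its divergence has integral zero; on `U` that
  -- divergence is the integrand, since `n` is divergence free there.
  rw [← integral_hdiv_eq_zero hψ.1 hψ.2.1]
  rw [← setIntegral_eq_integral_of_forall_compl_eq_zero (s := U)
    fun p hp => hdiv_eq_zero_of_notMem_tsupport fun hp' => hp (hψ.2.2 hp')]
  refine setIntegral_congr_fun hU.measurableSet fun p hp => ?_
  rw [hdiv_smul (hφ.differentiable (by simp) p)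
    ((hn.contDiffAt (hU.mem_nhds hp)).differentiableAt (by simp)), h0 p hp]
  ring

/-! ### The field `ν`. -/

lemma isOpen_offAxis : IsOpen offAxis := by
  have : offAxis = {p : Pt | p.1 ≠ 0} ∪ {p : Pt | p.2.1 ≠ 0} := by
    ext p
    simp only [offAxis, mem_ofPred_eq, mem_union]
    tauto
  rw [this]
  exact (isOpen_ne_fun (by fun_prop) (by fun_prop)).union
    (isOpen_ne_fun (by fun_prop) (by fun_prop))

lemma sq_add_sq_pos {p : Pt} (hp : p ∈ offAxis) : 0 < p.1 ^ 2 + p.2.1 ^ 2 := by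
  by_contra h
  have h1 := sq_nonneg p.1
  have h2 := sq_nonneg p.2.1
  exact hp ⟨pow_eq_zero_iff two_ne_zero |>.1 (by linarith),
    pow_eq_zero_iff two_ne_zero |>.1 (by linarith)⟩

lemma contDiffOn_nu : ContDiffOn ℝ ∞ nu offAxis := by
  intro p hp
  have h0 := (sq_add_sq_pos hp).ne'
  have hR : ContDiffAt ℝ ∞ (fun p : Pt => Real.sqrt (p.1 ^ 2 + p.2.1 ^ 2)) p :=
    ContDiffAt.sqrt (by fun_prop) h0
  have hR0 : Real.sqrt (p.1 ^ 2 + p.2.1 ^ 2) ≠ 0 := (Real.sqrt_pos.2 (sq_add_sq_pos hp)).ne'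
  refine ContDiffAt.contDiffWithinAt ?_
  unfold nu
  exact ((contDiffAt_snd.fst).neg.div hR hR0).prodMk (contDiffAt_fst.div hR hR0)

lemma sqLen_nu {p : Pt} (hp : p ∈ offAxis) : sqLen (nu p) = 1 := by
  have h0 := sq_add_sq_pos hp
  simp only [sqLen, nu, div_pow, Real.sq_sqrt h0.le]
  field_simp
  ring

/-- The rotation field `m = (-y, x)` is divergence free and orthogonal to the gradient of any
function of `x² + y²`. So the derivative of `g` cancels without being computed. -/
lemma hdiv_nu {p : Pt} (hp : p ∈ offAxis) : hdiv nu p = 0 := by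
  have h0 := sq_add_sq_pos hp
  set g : ℝ → ℝ := fun t => (Real.sqrt t)⁻¹
  set h : Pt → ℝ := fun q => q.1 ^ 2 + q.2.1 ^ 2
  set m : Pt → ℝ × ℝ := fun q => (-q.2.1, q.1)
  have hnu : nu = fun q => (fun r => g (h r)) q • m q := by
    ext q <;> simp [nu, g, h, m] <;> ring
  have hg : DifferentiableAt ℝ g (h p) :=
    ((differentiableAt_id).sqrt h0.ne').inv (Real.sqrt_pos.2 h0).ne'
  have hx : HasFDerivAt (fun q : Pt => q.1) (ContinuousLinearMap.fst ℝ ℝ (ℝ × ℝ)) p :=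
    hasFDerivAt_fst
  have hy : HasFDerivAt (fun q : Pt => q.2.1)
      (ContinuousLinearMap.fst ℝ ℝ ℝ ∘L ContinuousLinearMap.snd ℝ ℝ (ℝ × ℝ)) p :=
    (ContinuousLinearMap.fst ℝ ℝ ℝ ∘L ContinuousLinearMap.snd ℝ ℝ (ℝ × ℝ)).hasFDerivAt
  have hh : HasFDerivAt h _ p := (hx.pow 2).add (hy.pow 2)
  have hm : DifferentiableAt ℝ m p := by fun_prop
  have hgh : HasFDerivAt (fun r => g (h r)) _ p := hg.hasDerivAt.comp_hasFDerivAt p hh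
  rw [hnu, hdiv_smul hgh.differentiableAt hm]
  have e1 : (fun q => (m q).1) = fun q : Pt => -q.2.1 := rfl
  have e2 : (fun q => (m q).2) = fun q : Pt => q.1 := rfl
  have hm0 : hdiv m p = 0 := by
    rw [hdiv, X, Y, e1, e2, hx.fderiv, hy.fun_neg.fderiv]
    simp
  rw [hm0, X, Y, hgh.fderiv]
  simp [m]
  ring

lemma contDiffOn_smul_nu (σ : ℝ) : ContDiffOn ℝ ∞ (σ • nu) offAxis :=
  contDiffOn_nu.const_smul σ

/-! ### Gauss–Green in the `x` and `y` directions. -/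

/-- Since `π` recovers the parameter, the support of `φ ∘ γ` lies in the compact set `π (tsupport
φ)`. This serves slices and surface parametrizations alike. -/
lemma hasCompactSupport_comp_of_leftInverse {α β : Type*} [TopologicalSpace α]
    [TopologicalSpace β] [T2Space β] {φ : α → ℝ} (hφ : HasCompactSupport φ) {γ : β → α} {π : α → β}
    (hπ : Continuous π) (h : ∀ t, π (γ t) = t) : HasCompactSupport (fun t => φ (γ t)) :=
  HasCompactSupport.intro (hφ.image hπ) fun t ht =>
    image_eq_zero_of_notMem_tsupport fun h' => ht ⟨_, h', h t⟩

variable {a : ℝ → ℝ} {φ : Pt → ℝ}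

/-- Integration of `∂_x φ` over the set `x ≤ a(z) y`. -/
lemma setIntegral_partial_x (ha : Continuous a) {w : ℝ → ℝ} (hw : Continuous w)
    (hφ : ContDiff ℝ ∞ φ) (hc : HasCompactSupport φ) :
    ∫ p in {p : Pt | p.1 ≤ a p.2.2 * p.2.1}, w p.2.2 * fderiv ℝ φ p (1, 0, 0) =
      ∫ q : ℝ × ℝ, w q.2 * φ (a q.2 * q.1, q.1, q.2) := by
  have hG : MeasurableSet {p : Pt | p.1 ≤ a p.2.2 * p.2.1} :=
    (isClosed_le (by fun_prop) (by fun_prop)).measurableSet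
  have hi : Integrable (fun p : Pt => w p.2.2 * fderiv ℝ φ p (1, 0, 0)) :=
    (Continuous.mul (by fun_prop) ((hφ.continuous_fderiv (by simp)).clm_apply
      continuous_const)).integrable_of_hasCompactSupport (hc.fderiv_apply ℝ _).mul_left
  rw [← integral_indicator hG, Measure.volume_eq_prod, integral_prod_symm _ (hi.indicator hG)]
  congr 1
  ext q
  have hslice : ContDiff ℝ 1 fun x : ℝ => φ (x, q) :=
    (hφ.of_le (by simp)).comp (contDiff_prodMk_left q)
  have hcs : HasCompactSupport fun x : ℝ => φ (x, q) :=
    hasCompactSupport_comp_of_leftInverse hc continuous_fst fun _ => rfl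
  have hd : ∀ x : ℝ, deriv (fun x : ℝ => φ (x, q)) x = fderiv ℝ φ (x, q) (1, 0, 0) := fun x =>
    ((hφ.differentiable (by simp) (x, q)).hasFDerivAt.comp_hasDerivAt x
      ((hasDerivAt_id x).prodMk (hasDerivAt_const x q))).deriv
  rw [← hcs.integral_Iic_deriv_eq hslice, ← integral_const_mul, ← integral_indicator measurableSet_Iic]
  congr 1
  ext x
  simp [indicator_apply, hd]

/-- The map `(u, y, z) ↦ (u + a(z) y, y, z)`, which straightens the set `x ≤ a(z) y`. -/
def shear (a : ℝ → ℝ) (p : Pt) : Pt := (p.1 + a p.2.2 * p.2.1, p.2)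

/-- For fixed `(y, z)` the map translates in `x`, so Fubini suffices and `a` need not be
differentiable. -/
lemma measurePreserving_shear (ha : Continuous a) :
    MeasurePreserving (shear a) volume volume := by
  have h : MeasurePreserving
      (fun p : (ℝ × ℝ) × ℝ => (p.1, p.2 + a p.1.2 * p.1.1)) volume volume :=
    (MeasurePreserving.id (volume : Measure (ℝ × ℝ))).skew_product (μc := (volume : Measure ℝ))
      (μd := (volume : Measure ℝ)) (g := fun q x => x + a q.2 * q.1) (by fun_prop)
      (Eventually.of_forall fun q => (measurePreserving_add_right volume _).map_eq)
  exact (Measure.measurePreserving_swap.comp h).comp Measure.measurePreserving_swap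

/-- The field `∂_y + a(z) ∂_x` is tangent to the surface `x = a(z) y`. -/
lemma setIntegral_tangent (ha : Continuous a) (hφ : ContDiff ℝ ∞ φ) (hc : HasCompactSupport φ) :
    ∫ p in {p : Pt | p.1 ≤ a p.2.2 * p.2.1},
      (fderiv ℝ φ p (0, 1, 0) + a p.2.2 * fderiv ℝ φ p (1, 0, 0)) = 0 := by
  set G := {p : Pt | p.1 ≤ a p.2.2 * p.2.1} with hGdef
  set F : Pt → ℝ := fun p => fderiv ℝ φ p (0, 1, 0) + a p.2.2 * fderiv ℝ φ p (1, 0, 0)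
  have hG : MeasurableSet G := (isClosed_le (by fun_prop) (by fun_prop)).measurableSet
  have hdc := hφ.continuous_fderiv (by simp)
  have hF : Continuous F := (hdc.clm_apply continuous_const).add
    (Continuous.mul (by fun_prop) (hdc.clm_apply continuous_const))
  have hFc : HasCompactSupport F := (hc.fderiv_apply ℝ _).add (hc.fderiv_apply ℝ _).mul_left
  have hT : Continuous (shear a) := by unfold shear; fun_prop
  have hFT : Continuous fun p => F (shear a p) := hF.comp hT
  have hFTc : HasCompactSupport fun p => F (shear a p) :=
    hasCompactSupport_comp_of_leftInverse (π := fun p : Pt => (p.1 - a p.2.2 * p.2.1, p.2)) hFc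
      (by fun_prop) fun p => by simp [shear]
  have hN : MeasurableSet {p : Pt | p.1 ≤ 0} := measurableSet_le measurable_fst measurable_const
  have hpre : ∀ p, G.indicator F (shear a p) = {p : Pt | p.1 ≤ 0}.indicator
      (fun p => F (shear a p)) p := by
    intro p
    simp [indicator_apply, hGdef, shear]
  rw [← integral_indicator hG, ← (measurePreserving_shear ha).map_eq,
    integral_map hT.measurable.aemeasurable
      ((hF.measurable.indicator hG).aestronglyMeasurable)]
  simp only [hpre]
  rw [Measure.volume_eq_prod, integral_prod _
    ((hFT.integrable_of_hasCompactSupport hFTc).indicator hN)]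
  refine integral_eq_zero_of_ae (Eventually.of_forall fun u => ?_)
  have hslice : HasCompactSupport fun q : ℝ × ℝ => F (shear a (u, q)) :=
    hasCompactSupport_comp_of_leftInverse hFTc continuous_snd fun _ => rfl
  have hzero : ∫ q : ℝ × ℝ, F (shear a (u, q)) = 0 := by
    rw [Measure.volume_eq_prod, integral_prod_symm _ (by
      exact (hFT.comp (by fun_prop)).integrable_of_hasCompactSupport hslice)]
    refine integral_eq_zero_of_ae (Eventually.of_forall fun z => ?_)
    have hφs : HasCompactSupport fun y : ℝ => φ (shear a (u, y, z)) :=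
      hasCompactSupport_comp_of_leftInverse (π := fun p : Pt => p.2.1) hc (by fun_prop)
        fun _ => rfl
    have hFs : HasCompactSupport fun y : ℝ => F (shear a (u, y, z)) :=
      hasCompactSupport_comp_of_leftInverse (π := fun p : Pt => p.2.1) hFc (by fun_prop)
        fun _ => rfl
    -- For fixed `u` and `z`, the straightened integrand is the `y`-derivative of `φ ∘ shear a`.
    refine integral_eq_zero_of_hasDerivAt_of_integrable (f := fun y => φ (shear a (u, y, z)))
      (fun y => ?_)
      ((hFT.comp (by fun_prop)).integrable_of_hasCompactSupport hFs)
      ((hφ.continuous.comp (hT.comp (by fun_prop))).integrable_of_hasCompactSupport hφs)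
    have hcurve : HasDerivAt (fun y : ℝ => shear a (u, y, z)) (a z, 1, 0) y := by
      have h1 : HasDerivAt (fun y : ℝ => u + a z * y) (a z) y := by
        simpa using ((hasDerivAt_id y).const_mul (a z)).const_add u
      exact h1.prodMk ((hasDerivAt_id y).prodMk (hasDerivAt_const y z))
    have := (hφ.differentiable (by simp) (shear a (u, y, z))).hasFDerivAt.comp_hasDerivAt y hcurve
    refine this.congr_deriv ?_
    have hv : ((a z, 1, 0) : Pt) = (0, 1, 0) + a z • (1, 0, 0) := by simp
    rw [hv, map_add, map_smul]
    simp [F, shear]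
  by_cases hu : u ≤ 0
  · simpa [indicator_apply, hu] using hzero
  · simp [hu]

/-- Integration of `∂_y φ` over the set `x ≤ a(z) y`. -/
lemma setIntegral_partial_y (ha : Continuous a) (hφ : ContDiff ℝ ∞ φ)
    (hc : HasCompactSupport φ) :
    ∫ p in {p : Pt | p.1 ≤ a p.2.2 * p.2.1}, fderiv ℝ φ p (0, 1, 0) =
      -∫ q : ℝ × ℝ, a q.2 * φ (a q.2 * q.1, q.1, q.2) := by
  have hdc := hφ.continuous_fderiv (by simp)
  have hi : Integrable (fun p : Pt => a p.2.2 * fderiv ℝ φ p (1, 0, 0)) :=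
    (Continuous.mul (by fun_prop) (hdc.clm_apply
      continuous_const)).integrable_of_hasCompactSupport (hc.fderiv_apply ℝ _).mul_left
  have h := setIntegral_tangent ha hφ hc
  rw [integral_add (integrable_fderiv_apply hφ hc _).integrableOn hi.integrableOn,
    setIntegral_partial_x ha ha hφ hc] at h
  linarith

/-! ### Gauss–Green in the vertical direction. -/

/-- The levels that `a` reaches, but not from the start. -/
def levels (a : ℝ → ℝ) : Set ℝ := {c | (∃ z, a z < c) ∧ ∃ z, c ≤ a z}

/-- The smallest point at which the monotone function `a` reaches the level `c`. -/
noncomputable def level (a : ℝ → ℝ) (c : ℝ) : ℝ := sInf {z | c ≤ a z}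

/-- The superlevel set is an up-set by monotonicity and closed by continuity, so its infimum is
attained; a point with `a z₀ < c` bounds it below. -/
lemma setOf_le_eq_Ici (ha : Continuous a) (hm : Monotone a) {c : ℝ} (hcl : c ∈ levels a) :
    {z | c ≤ a z} = Ici (level a c) := by
  obtain ⟨⟨z₀, h₀⟩, hne⟩ := hcl
  have hbdd : BddBelow {z | c ≤ a z} := ⟨z₀, fun z hz => by
    by_contra hlt
    exact absurd (hm (not_le.1 hlt).le) (not_le.2 (h₀.trans_le hz))⟩
  have hmem : c ≤ a (level a c) :=
    (isClosed_le continuous_const ha).csInf_mem (s := {z | c ≤ a z}) hne hbdd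
  ext z
  exact ⟨fun hz => csInf_le hbdd hz, fun hz => hmem.trans (hm hz)⟩

lemma setOf_le_eq_of_notMem {c : ℝ} (hcl : c ∉ levels a) :
    {z | c ≤ a z} = univ ∨ {z | c ≤ a z} = ∅ := by
  by_cases h : ∃ z, c ≤ a z
  · left
    ext z
    simp only [mem_ofPred_eq, mem_univ, iff_true]
    by_contra hz
    exact hcl ⟨⟨z, not_le.1 hz⟩, h⟩
  · right
    push Not at h
    ext z
    simpa using h z

lemma measurableSet_levels : MeasurableSet (levels a) := by
  refine OrdConnected.measurableSet ⟨fun c hc d hd e he => ?_⟩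
  obtain ⟨⟨z, hz⟩, -⟩ := hc
  obtain ⟨-, ⟨z', hz'⟩⟩ := hd
  exact ⟨⟨z, hz.trans_le he.1⟩, ⟨z', he.2.trans hz'⟩⟩

lemma measurable_level (ha : Continuous a) (hm : Monotone a) : Measurable (level a) := by
  refine measurable_of_Iic fun t => ?_
  -- Outside `levels a` the infimum is over the whole line or the empty set, and `sInf` takes the
  -- default value `0` for both. This accounts for the second piece.
  have : level a ⁻¹' Iic t = (levels a ∩ Iic (a t)) ∪ ((levels a)ᶜ ∩ {_c | 0 ≤ t}) := by
    ext c
    by_cases hcl : c ∈ levels a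
    · have := Set.ext_iff.1 (setOf_le_eq_Ici ha hm hcl) t
      simp only [mem_ofPred_eq, mem_Ici] at this
      simp [hcl, this]
    · have : level a c = 0 := by
        rcases setOf_le_eq_of_notMem hcl with h | h <;> simp [level, h]
      simp [hcl, this]
  rw [this]
  exact (measurableSet_levels.inter measurableSet_Iic).union
    (measurableSet_levels.compl.inter (MeasurableSet.const _))

/-- The pairs `(x, y)` for which the vertical line over `(x, y)` crosses the surface
`x = a(z) y`. -/
def crossing (a : ℝ → ℝ) : Set (ℝ × ℝ) := {q | q.1 / q.2 ∈ levels a}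

lemma measurableSet_crossing : MeasurableSet (crossing a) :=
  measurableSet_levels.preimage (f := fun q : ℝ × ℝ => q.1 / q.2) (by fun_prop)

lemma measurableSet_slope_le (ha : Continuous a) :
    MeasurableSet {p : Pt | p.1 / p.2.1 ≤ a p.2.2} :=
  measurableSet_le (by fun_prop) (by have := ha.measurable; fun_prop)

/-- Integration of `∂_z φ` over the set `x / y ≤ a(z)`. -/
lemma setIntegral_partial_z (ha : Continuous a) (hm : Monotone a) (hφ : ContDiff ℝ ∞ φ)
    (hc : HasCompactSupport φ) :
    ∫ p in {p : Pt | p.1 / p.2.1 ≤ a p.2.2}, fderiv ℝ φ p (0, 0, 1) =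
      -∫ q in crossing a, φ (q.1, q.2, level a (q.1 / q.2)) := by
  have hE := measurableSet_slope_le ha
  have hi := (integrable_fderiv_apply hφ hc (0, 0, 1)).indicator hE
  have hmp := volume_preserving_prodAssoc (α₁ := ℝ) (β₁ := ℝ) (γ₁ := ℝ)
  rw [← integral_indicator hE, ← hmp.integral_comp MeasurableEquiv.prodAssoc.measurableEmbedding,
    ← integral_indicator measurableSet_crossing, ← integral_neg, Measure.volume_eq_prod,
    integral_prod _ (by exact (hmp.integrable_comp_emb
      MeasurableEquiv.prodAssoc.measurableEmbedding).2 hi)]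
  congr 1
  ext q
  have hslice : ContDiff ℝ 1 fun z : ℝ => φ (q.1, q.2, z) :=
    (hφ.of_le (by simp)).comp (by fun_prop)
  have hcs : HasCompactSupport fun z : ℝ => φ (q.1, q.2, z) :=
    hasCompactSupport_comp_of_leftInverse (π := fun p : Pt => p.2.2) hc (by fun_prop) fun _ => rfl
  have hd : ∀ z : ℝ, HasDerivAt (fun z : ℝ => φ (q.1, q.2, z))
      (fderiv ℝ φ (q.1, q.2, z) (0, 0, 1)) z := fun z =>
    (hφ.differentiable (by simp) (q.1, q.2, z)).hasFDerivAt.comp_hasDerivAt z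
      ((hasDerivAt_const z q.1).prodMk ((hasDerivAt_const z q.2).prodMk (hasDerivAt_id z)))
  have hd' : deriv (fun z : ℝ => φ (q.1, q.2, z)) =
    fun z => fderiv ℝ φ (q.1, q.2, z) (0, 0, 1) := funext fun z => (hd z).deriv
  have hleft : ∀ z : ℝ, {p : Pt | p.1 / p.2.1 ≤ a p.2.2}.indicator
      (fun p => fderiv ℝ φ p (0, 0, 1)) (MeasurableEquiv.prodAssoc (q, z)) =
      {z | q.1 / q.2 ≤ a z}.indicator (fun z => fderiv ℝ φ (q.1, q.2, z) (0, 0, 1)) z := fun z =>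
    rfl
  simp only [hleft]
  -- A half-line contributes its boundary value; the whole line and the empty set contribute
  -- nothing. The case `y = 0` is no exception, with `x / 0 = 0` on both sides.
  by_cases hq : q ∈ crossing a
  · rw [setOf_le_eq_Ici ha hm hq, integral_indicator measurableSet_Ici, integral_Ici_eq_integral_Ioi,
      indicator_of_mem hq, ← hcs.integral_Ioi_deriv_eq hslice, hd']
  · rw [indicator_of_notMem hq, neg_zero]
    rcases setOf_le_eq_of_notMem hq with h | h
    · rw [h, indicator_univ]
      refine integral_eq_zero_of_hasDerivAt_of_integrable hd ?_
        (hslice.continuous.integrable_of_hasCompactSupport hcs)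
      rw [← hd']
      exact (hslice.continuous_deriv le_rfl).integrable_of_hasCompactSupport hcs.deriv
    · simp [h]

/-- For fixed `(y, z)` the slice of the surface is a single point. -/
lemma ae_ne_surface (ha : Continuous a) : ∀ᵐ p : Pt, p.1 ≠ a p.2.2 * p.2.1 := by
  have hm : MeasurableSet {p : Pt | p.1 = a p.2.2 * p.2.1} :=
    (isClosed_eq (by fun_prop) (by fun_prop)).measurableSet
  rw [ae_iff]
  simp only [ne_eq, not_not]
  rw [Measure.volume_eq_prod, Measure.prod_apply_symm hm]
  simp

/-! ### Gauss–Green on one side of `y = 0`. -/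

/-- The subset of `ℍ` on which `y` has the sign `σ`. -/
def side (σ : ℝ) : Set Pt := {p | 0 < σ * p.2.1}

lemma isOpen_side (σ : ℝ) : IsOpen (side σ) := isOpen_lt (by fun_prop) (by fun_prop)

lemma side_subset_offAxis (σ : ℝ) : side σ ⊆ offAxis := by
  rintro p hp ⟨-, h⟩
  simp [side, h] at hp

/-- For integrands supported on one side, the set `x ≤ a(z) y` can be replaced by
`x / y ≤ a(z)`. -/
lemma setIntegral_subgraph_eq (ha : Continuous a) {σ : ℝ} (hσ : σ = 1 ∨ σ = -1) {g : Pt → ℝ}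
    (hg : Integrable g) (hg0 : ∀ p ∉ side σ, g p = 0) (hgi : ∫ p, g p = 0) :
    ∫ p in {p : Pt | p.1 ≤ a p.2.2 * p.2.1}, g p =
      σ * ∫ p in {p : Pt | p.1 / p.2.1 ≤ a p.2.2}, g p := by
  have hG : MeasurableSet {p : Pt | p.1 ≤ a p.2.2 * p.2.1} :=
    (isClosed_le (by fun_prop) (by fun_prop)).measurableSet
  have hE := measurableSet_slope_le ha
  rw [← integral_indicator hG, ← integral_indicator hE]
  rcases hσ with rfl | rfl
  · rw [one_mul]
    congr 1
    ext p
    by_cases hp : p ∈ side 1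
    · have hy : 0 < p.2.1 := by simpa [side] using hp
      simp [indicator_apply, div_le_iff₀ hy]
    · simp [indicator_apply, hg0 p hp]
  -- Dividing by `y < 0` reverses the inequality, so on this side the two sets are complementary up
  -- to the null surface. As `g` has integral zero, the integrals are opposite.
  · have key : (fun p => {p : Pt | p.1 ≤ a p.2.2 * p.2.1}.indicator g p +
        {p : Pt | p.1 / p.2.1 ≤ a p.2.2}.indicator g p) =ᵐ[volume] g := by
      filter_upwards [ae_ne_surface ha] with p hp
      by_cases hs : p ∈ side (-1)
      · have hy : p.2.1 < 0 := by simpa [side] using hs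
        by_cases h : p.1 ≤ a p.2.2 * p.2.1
        · have h' := not_le.2 (lt_of_le_of_ne h hp)
          simp [div_le_iff_of_neg hy, h, h']
        · simp [div_le_iff_of_neg hy, h, (not_le.1 h).le]
      · simp [indicator_apply, hg0 p hs]
    have := integral_congr_ae key
    rw [integral_add (hg.indicator hG) (hg.indicator hE), hgi] at this
    linarith

/-- The embedding of the surface `x = a(z) y` by the coordinates `(y, z)`. -/
def surfaceYZ (a : ℝ → ℝ) (q : ℝ × ℝ) : Pt := (a q.2 * q.1, q.1, q.2)

/-- The embedding of the surface `x = a(z) y` by the coordinates `(x, y)`. -/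
noncomputable def surfaceXY (a : ℝ → ℝ) (q : ℝ × ℝ) : Pt := (q.1, q.2, level a (q.1 / q.2))

lemma continuous_surfaceYZ (ha : Continuous a) : Continuous (surfaceYZ a) := by
  unfold surfaceYZ
  fun_prop

lemma measurable_surfaceXY (ha : Continuous a) (hm : Monotone a) :
    Measurable (surfaceXY a) := by
  have := measurable_level ha hm
  unfold surfaceXY
  fun_prop

/-- The Gauss--Green formula for the set `x ≤ a(z) y` on one side of `y = 0`. -/
lemma setIntegral_hdiv_subgraph (ha : Continuous a) (hm : Monotone a) {σ : ℝ}
    (hσ : σ = 1 ∨ σ = -1) {ψ : HField} (hψ : IsTestField (side σ) ψ) :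
    ∫ p in {p : Pt | p.1 ≤ a p.2.2 * p.2.1}, hdiv ψ p =
      (∫ q : ℝ × ℝ, ((ψ (surfaceYZ a q)).1 - a q.2 * (ψ (surfaceYZ a q)).2)) +
      ∫ q in crossing a, σ * (q.2 / 2 * (ψ (surfaceXY a q)).1 -
        q.1 / 2 * (ψ (surfaceXY a q)).2) := by
  obtain ⟨hs, hc, hsub⟩ := hψ
  have c1 : HasCompactSupport fun q => (ψ q).1 := hc.comp_left (g := Prod.fst) rfl
  have c2 : HasCompactSupport fun q => (ψ q).2 := hc.comp_left (g := Prod.snd) rfl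
  have hh : ContDiff ℝ ∞ fun q : Pt => q.1 / 2 * (ψ q).2 - q.2.1 / 2 * (ψ q).1 :=
    ((contDiff_fst.div_const 2).mul hs.snd).sub ((contDiff_snd.fst.div_const 2).mul hs.fst)
  have hhc : HasCompactSupport fun q : Pt => q.1 / 2 * (ψ q).2 - q.2.1 / 2 * (ψ q).1 :=
    (c2.mul_left (f := fun q : Pt => q.1 / 2)).sub (c1.mul_left (f := fun q : Pt => q.2.1 / 2))
  have hh0 : ∀ p ∉ side σ,
      fderiv ℝ (fun q : Pt => q.1 / 2 * (ψ q).2 - q.2.1 / 2 * (ψ q).1) p (0, 0, 1) = 0 := by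
    intro p hp
    have : (fun q : Pt => q.1 / 2 * (ψ q).2 - q.2.1 / 2 * (ψ q).1) =ᶠ[𝓝 p] fun _ => 0 := by
      filter_upwards [notMem_tsupport_iff_eventuallyEq.1 fun h => hp (hsub h)] with q hq
      simp [hq]
    rw [this.fderiv_eq]
    simp
  have hA := setIntegral_partial_x ha continuous_const (w := fun _ => (1 : ℝ)) hs.fst c1
  simp only [one_mul] at hA
  have hΦ := continuous_surfaceYZ ha
  have i1 : Integrable fun q : ℝ × ℝ => (ψ (surfaceYZ a q)).1 :=
    (hs.continuous.fst.comp hΦ).integrable_of_hasCompactSupport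
      (hasCompactSupport_comp_of_leftInverse c1 continuous_snd fun _ => rfl)
  have i2 : Integrable fun q : ℝ × ℝ => a q.2 * (ψ (surfaceYZ a q)).2 :=
    (Continuous.mul (f := fun q : ℝ × ℝ => a q.2) (by fun_prop)
      (hs.continuous.snd.comp hΦ)).integrable_of_hasCompactSupport
      (hasCompactSupport_comp_of_leftInverse c2 continuous_snd fun _ => rfl).mul_left
  rw [setIntegral_hdiv hs hc, hA, setIntegral_partial_y ha hs.snd c2,
    setIntegral_subgraph_eq ha hσ (integrable_fderiv_apply hh hhc _) hh0
      (integral_fderiv_apply_eq_zero hh hhc _),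
    setIntegral_partial_z ha hm hh hhc, integral_sub i1 i2, integral_const_mul,
    ← integral_neg (μ := volume.restrict (crossing a)), ← sub_eq_add_neg]
  congr 3
  ext q
  simp only [surfaceXY]
  ring

/-! ### The perimeter measure and the normal. -/

/-- The distance to the vertical axis. -/
noncomputable def radius (p : Pt) : ℝ := Real.sqrt (p.1 ^ 2 + p.2.1 ^ 2)

lemma continuous_radius : Continuous radius := by unfold radius; fun_prop

/-- The part of the perimeter measure of `x ≤ a(z) y` that comes from the derivative along
horizontal planes. -/
noncomputable def perimeterYZ (a : ℝ → ℝ) : Measure Pt :=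
  (Measure.map (surfaceYZ a) volume).withDensity
    fun p => ((radius p / |p.2.1|).toNNReal : ENNReal)

/-- The part of the perimeter measure of `x ≤ a(z) y` that comes from the vertical
derivative. -/
noncomputable def perimeterXY (a : ℝ → ℝ) : Measure Pt :=
  (Measure.map (surfaceXY a) (volume.restrict (crossing a))).withDensity
    fun p => ((radius p / 2).toNNReal : ENNReal)

lemma map_surfaceYZ_lt_top (ha : Continuous a) {K : Set Pt} (hK : IsCompact K) :
    Measure.map (surfaceYZ a) volume K < ⊤ := by
  rw [Measure.map_apply (continuous_surfaceYZ ha).measurable hK.measurableSet]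
  exact (measure_mono (t := Prod.snd '' K) fun q hq =>
    ⟨surfaceYZ a q, hq, rfl⟩).trans_lt
    (hK.image continuous_snd).measure_lt_top

lemma map_surfaceXY_lt_top (ha : Continuous a) (hm : Monotone a) {K : Set Pt}
    (hK : IsCompact K) :
    Measure.map (surfaceXY a) (volume.restrict (crossing a)) K < ⊤ := by
  rw [Measure.map_apply (measurable_surfaceXY ha hm) hK.measurableSet]
  refine (Measure.restrict_apply_le _ _).trans_lt ?_
  exact (measure_mono (t := (fun p : Pt => (p.1, p.2.1)) '' K) fun q hq =>
    ⟨surfaceXY a q, hq, rfl⟩).trans_lt (hK.image (by fun_prop)).measure_lt_top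

/-- The density blows up at `y = 0`, but is continuous and hence bounded on a compact subset of one
side. -/
lemma perimeterYZ_lt_top (ha : Continuous a) {σ : ℝ} {K : Set Pt} (hK : IsCompact K)
    (hKs : K ⊆ side σ) : perimeterYZ a K < ⊤ := by
  rw [perimeterYZ, withDensity_apply _ hK.measurableSet]
  refine setLIntegral_lt_top_of_bddAbove (map_surfaceYZ_lt_top ha hK).ne ?_
  refine hK.bddAbove_image ?_
  refine continuous_real_toNNReal.comp_continuousOn
    (continuous_radius.continuousOn.div (by fun_prop) fun p hp => ?_)
  have := hKs hp
  intro h0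
  simp only [side, mem_ofPred_eq, abs_eq_zero.1 h0, mul_zero, lt_irrefl] at this

lemma perimeterXY_lt_top (ha : Continuous a) (hm : Monotone a) {K : Set Pt}
    (hK : IsCompact K) : perimeterXY a K < ⊤ := by
  rw [perimeterXY, withDensity_apply _ hK.measurableSet]
  exact setLIntegral_lt_top_of_bddAbove (map_surfaceXY_lt_top ha hm hK).ne
    (hK.bddAbove_image
      (continuous_real_toNNReal.comp (continuous_radius.div_const 2)).continuousOn)

lemma measurable_nu : Measurable nu := by unfold nu; fun_prop

lemma measurable_dot {n ψ : HField} (hψ : Measurable ψ) (hn : Measurable n) :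
    Measurable fun p => dot (ψ p) (n p) := by
  unfold dot
  exact (hψ.fst.mul hn.fst).add (hψ.snd.mul hn.snd)

/-- Continuity of `n` is available only on `U`; there it bounds the integrand on the compact support
of `ψ`, outside which the integrand is zero. -/
lemma integrable_dot {μ : Measure Pt} {n : HField} {U : Set Pt} (hn : Measurable n)
    (hnU : ContinuousOn n U) {ψ : HField} (hψ : IsTestField U ψ)
    (hμ : μ (tsupport ψ) < ⊤) : Integrable (fun p => dot (ψ p) (n p)) μ := by
  have hψc := hψ.1.continuous
  have hcont : ContinuousOn (fun p => dot (ψ p) (n p)) (tsupport ψ) := by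
    have := hnU.mono hψ.2.2
    unfold dot
    exact (hψc.fst.continuousOn.mul this.fst).add (hψc.snd.continuousOn.mul this.snd)
  obtain ⟨C, hC⟩ := (show IsCompact (tsupport ψ) from hψ.2.1).exists_bound_of_continuousOn hcont
  have hmeas := measurable_dot hψc.measurable hn
  have h0 : ∀ p ∉ tsupport ψ, dot (ψ p) (n p) = 0 := fun p hp => by
    simp [dot, image_eq_zero_of_notMem_tsupport hp]
  refine (integrableOn_iff_integrable_of_support_subset (s := tsupport ψ)
    fun p hp => ?_).1 ?_
  · by_contra h
    exact hp (h0 p h)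
  · refine Measure.integrableOn_of_bounded (M := C) hμ.ne hmeas.aestronglyMeasurable ?_
    exact (ae_restrict_iff' (isClosed_tsupport ψ).measurableSet).2 (Eventually.of_forall hC)

lemma dot_smul_nu (σ : ℝ) (v : ℝ × ℝ) (p : Pt) :
    dot v ((σ • nu) p) = σ * (v.2 * p.1 - v.1 * p.2.1) / radius p := by
  simp only [dot, nu, radius, Pi.smul_apply, Prod.smul_fst, Prod.smul_snd, smul_eq_mul]
  ring

lemma radius_pos {p : Pt} (hp : p ∈ offAxis) : 0 < radius p := Real.sqrt_pos.2 (sq_add_sq_pos hp)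

/-- The field `σ ν` is the inward normal of `x ≤ a(z) y` on the side `σ y > 0`. -/
lemma smoothNormal_subgraph (ha : Continuous a) (hm : Monotone a) {σ : ℝ}
    (hσ : σ = 1 ∨ σ = -1) :
    SmoothNormal {p : Pt | p.1 ≤ a p.2.2 * p.2.1} (side σ) (perimeterYZ a + perimeterXY a)
      (σ • nu) := by
  have hσ2 : σ * σ = 1 := by rcases hσ with rfl | rfl <;> norm_num
  have hcont : ContDiffOn ℝ ∞ (σ • nu) (side σ) :=
    (contDiffOn_smul_nu σ).mono (side_subset_offAxis σ)
  have hfin : ∀ K : Set Pt, IsCompact K → K ⊆ side σ → (perimeterYZ a + perimeterXY a) K < ⊤ :=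
    fun K hK hKs => by
      rw [Measure.add_apply]
      exact ENNReal.add_lt_top.2 ⟨perimeterYZ_lt_top ha hK hKs, perimeterXY_lt_top ha hm hK⟩
  have hmn : Measurable (σ • nu) := measurable_nu.const_smul σ
  refine ⟨isOpen_side σ, hcont, fun p hp => ?_, fun p hp => ?_,
    (isClosed_le (by fun_prop) (by fun_prop)).measurableSet.nullMeasurableSet, hfin,
    fun ψ hψ => ?_⟩
  · have := sqLen_nu (side_subset_offAxis σ hp)
    have h2 : sqLen ((σ • nu) p) = σ * σ * sqLen (nu p) := by simp [sqLen]; ring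
    rw [h2, this, hσ2, one_mul]
  · have := hdiv_nu (side_subset_offAxis σ hp)
    rcases hσ with rfl | rfl
    · simpa using this
    · rw [neg_one_smul, hdiv_neg, this, neg_zero]
  · have hψ0 : ∀ p ∉ side σ, ψ p = 0 := fun p hp =>
      image_eq_zero_of_notMem_tsupport fun h => hp (hψ.2.2 h)
    have hmeas : Measurable fun p => dot (ψ p) ((σ • nu) p) :=
      measurable_dot hψ.1.continuous.measurable hmn
    rw [setIntegral_hdiv_subgraph ha hm hσ hψ, setIntegral_eq_integral_of_forall_compl_eq_zero
      (s := side σ) (fun p hp => by simp [dot, hψ0 p hp]), integral_add_measure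
      (integrable_dot hmn hcont.continuousOn hψ (perimeterYZ_lt_top ha hψ.2.1 hψ.2.2))
      (integrable_dot hmn hcont.continuousOn hψ (perimeterXY_lt_top ha hm hψ.2.1)), neg_add]
    have m1 : Measurable fun p : Pt => (radius p / |p.2.1|).toNNReal :=
      (continuous_radius.measurable.div (by fun_prop)).real_toNNReal
    have m2 : Measurable fun p : Pt => (radius p / 2).toNNReal :=
      (continuous_radius.measurable.div_const 2).real_toNNReal
    congr 1
    -- On `x = a(z) y` the pairing with `σ ν` is `σ y (a ψ₂ - ψ₁) / radius`; the density `radius /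
    -- |y|`, with `|y| = σ y`, reduces it to `a ψ₂ - ψ₁`.
    · rw [perimeterYZ, integral_withDensity_eq_integral_smul m1,
        integral_map (continuous_surfaceYZ ha).measurable.aemeasurable
          (by exact (m1.smul hmeas).aestronglyMeasurable), ← integral_neg]
      congr 1
      ext q
      by_cases hq : surfaceYZ a q ∈ side σ
      · have hR := radius_pos (side_subset_offAxis σ hq)
        have hy : 0 < σ * q.1 := hq
        have habs : |q.1| = σ * q.1 := by
          rcases hσ with rfl | rfl
          · simpa using (by simpa using hy : 0 < q.1).le
          · simpa using (by simpa using hy : q.1 < 0).le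
        rw [dot_smul_nu, NNReal.smul_def, Real.coe_toNNReal _ (by positivity), smul_eq_mul]
        have hq1 : q.1 ≠ 0 := fun h => by simp [h] at hy
        have hσ0 : σ ≠ 0 := fun h => by simp [h] at hy
        simp only [surfaceYZ, habs] at hR ⊢
        field_simp
        ring
      · simp [hψ0 _ hq, dot]
    -- Here the density `radius / 2` turns the pairing into `σ (x ψ₂ - y ψ₁) / 2`.
    · rw [perimeterXY, integral_withDensity_eq_integral_smul m2,
        integral_map (measurable_surfaceXY ha hm).aemeasurable
          (by exact (m2.smul hmeas).aestronglyMeasurable), ← integral_neg]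
      congr 1
      ext q
      by_cases hq : surfaceXY a q ∈ side σ
      · have hR := radius_pos (side_subset_offAxis σ hq)
        rw [dot_smul_nu, NNReal.smul_def, Real.coe_toNNReal _ (by positivity), smul_eq_mul]
        simp only [surfaceXY] at hR ⊢
        field_simp
        ring
      · simp [hψ0 _ hq, dot]

lemma SmoothNormal.isCalibration {G U : Set Pt} {μ : Measure Pt} {n : HField}
    (h : SmoothNormal G U μ n) : IsCalibration n G U :=
  ⟨h.contDiffOn.continuousOn, h.unit,
    isDivFreeOn_of_hdiv_eq_zero h.isOpen h.contDiffOn h.hdiv_eq_zero, h.nullMeasurable,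
    μ, n, h.hasPerimeterNormal, Filter.EventuallyEq.rfl⟩

/-- Every point has a neighbourhood in which the perimeter is finite and minimal. -/
lemma SmoothNormal.exists_isPerimeterMinimizer {G U : Set Pt} {μ : Measure Pt} {n : HField}
    (h : SmoothNormal G U μ n) {p : Pt} (hp : p ∈ U) :
    ∃ V : Set Pt, IsOpen V ∧ p ∈ V ∧ V ⊆ U ∧ perimeter G V < ⊤ ∧ IsPerimeterMinimizer G V := by
  obtain ⟨K, hK, hpK, hKU⟩ := exists_compact_subset h.isOpen hp
  have hVU : interior K ⊆ U := interior_subset.trans hKU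
  refine ⟨interior K, isOpen_interior, hpK, hVU, ?_, h.isPerimeterMinimizer isOpen_interior hVU⟩
  rw [← h.measure_eq_perimeter isOpen_interior hVU]
  exact (measure_mono interior_subset).trans_lt (h.finite_compact K hK hKU)

/-! ### Graphical strips as sets `x ≤ a(z) y`. -/

section strip

variable {f : ℝ × ℝ → ℝ}

/-- Monotonicity compares the continuous function of `τ` with `a 0 * (s ^ 2 / 2) + τ` at both ends,
so it is onto. -/
lemma IsGraphicalStrip.exists_param (h : IsGraphicalStrip a f) (s t : ℝ) :
    ∃ τ, a τ * (s ^ 2 / 2) + τ = t := by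
  obtain ⟨ha, hm, -⟩ := h
  have hs : 0 ≤ s ^ 2 / 2 := by positivity
  have hc : Continuous fun τ => a τ * (s ^ 2 / 2) + τ := by fun_prop
  refine hc.surjective ?_ ?_ t
  · refine tendsto_atTop_mono' _ ?_ (tendsto_atTop_add_const_left _ (a 0 * (s ^ 2 / 2)) tendsto_id)
    filter_upwards [eventually_ge_atTop 0] with τ hτ
    exact add_le_add_left (mul_le_mul_of_nonneg_right (hm hτ) hs) τ
  · refine tendsto_atBot_mono' _ ?_ (tendsto_atBot_add_const_left _ (a 0 * (s ^ 2 / 2)) tendsto_id)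
    filter_upwards [eventually_le_atBot 0] with τ hτ
    exact add_le_add_left (mul_le_mul_of_nonneg_right (hm hτ) hs) τ

/-- The subgraph of a graphical strip is the set `x ≤ a(z) y`. -/
lemma IsGraphicalStrip.subgraph_eq (h : IsGraphicalStrip a f) :
    subgraph f = {p : Pt | p.1 ≤ a p.2.2 * p.2.1} := by
  -- The group law gives `z = t - x y / 2`, hence the argument `t = z + x y / 2` of `f`.
  have key : ∀ x y z : ℝ, x ≤ f (y, z + x * y / 2) ↔ x ≤ a z * y := by
    intro x y z
    obtain ⟨τ, hτ⟩ := h.exists_param y (z + x * y / 2)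
    obtain ⟨-, hm, hf⟩ := h
    rw [← hτ, hf]
    -- This ties the sign of `a τ * y - x` to that of `z - τ`; monotonicity then compares `a z * y`
    -- with `a τ * y`.
    have hrel : (a τ * y - x) * y = 2 * (z - τ) := by linear_combination 2 * hτ
    rcases lt_trichotomy y 0 with hy | rfl | hy
    · constructor
      · intro hx
        have hzτ : z ≤ τ := by
          linarith [mul_nonpos_of_nonneg_of_nonpos (sub_nonneg.2 hx) hy.le]
        exact hx.trans (mul_le_mul_of_nonpos_right (hm hzτ) hy.le)
      · intro hx
        by_contra! hlt
        have hτz : τ ≤ z := by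
          linarith [mul_pos_of_neg_of_neg (sub_neg.2 hlt) hy]
        linarith [mul_le_mul_of_nonpos_right (hm hτz) hy.le]
    · simp
    · constructor
      · intro hx
        have hτz : τ ≤ z := by
          linarith [mul_nonneg (sub_nonneg.2 hx) hy.le]
        exact hx.trans (mul_le_mul_of_nonneg_right (hm hτz) hy.le)
      · intro hx
        by_contra! hlt
        have hzτ : z ≤ τ := by
          linarith [mul_neg_of_neg_of_pos (sub_neg.2 hlt) hy]
        linarith [mul_le_mul_of_nonneg_right (hm hzτ) hy.le]
  ext ⟨x, y, z⟩
  simp only [subgraph, mul, mem_ofPred_eq, Prod.mk.injEq, zero_add, zero_mul, add_zero]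
  constructor
  · rintro ⟨y', t, ξ, hξ, rfl, rfl, rfl⟩
    rw [← key]
    convert! hξ using 3
    ring
  · intro hx
    exact ⟨y, z + x * y / 2, x, (key x y z).2 hx, rfl, rfl, by ring⟩

/-- At `s = 0` the defining equation gives `f (0, t) = 0`, so the graph meets `y = 0` only in the
axis. -/
lemma IsGraphicalStrip.snd_ne_zero (h : IsGraphicalStrip a f) {p : Pt}
    (hp : p ∈ intrinsicGraph f ∩ offAxis) : p.2.1 ≠ 0 := by
  obtain ⟨⟨y, t, rfl⟩, hoff⟩ := hp
  intro hy
  have hy' : y = 0 := by simpa [mul] using hy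
  subst hy'
  have := h.2.2 0 t
  simp at this
  exact hoff ⟨by simp [mul, this], hy⟩

end strip

end Heisenberg

theorem mainTheorem8 :
    (ContDiffOn ℝ ∞ Heisenberg.nu Heisenberg.offAxis ∧
      (∀ p ∈ Heisenberg.offAxis, Heisenberg.hdiv Heisenberg.nu p = 0) ∧
      Heisenberg.IsDivFreeOn Heisenberg.nu Heisenberg.offAxis) ∧
    ∀ (a : ℝ → ℝ) (f : ℝ × ℝ → ℝ), Heisenberg.IsGraphicalStrip a f →
      (∀ p ∈ Heisenberg.intrinsicGraph f ∩ Heisenberg.offAxis,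
        ∃ U : Set Heisenberg.Pt, IsOpen U ∧ p ∈ U ∧ U ⊆ Heisenberg.offAxis ∧
          (Heisenberg.IsCalibration Heisenberg.nu (Heisenberg.subgraph f) U ∨
            Heisenberg.IsCalibration (-Heisenberg.nu) (Heisenberg.subgraph f) U)) ∧
      Heisenberg.IsCalibration Heisenberg.nu (Heisenberg.subgraph f) {p | 0 < p.2.1} ∧
      Heisenberg.IsCalibration (-Heisenberg.nu) (Heisenberg.subgraph f) {p | p.2.1 < 0} ∧
      (∀ p ∈ Heisenberg.intrinsicGraph f ∩ Heisenberg.offAxis,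
        ∃ U : Set Heisenberg.Pt, IsOpen U ∧ p ∈ U ∧ U ⊆ Heisenberg.offAxis ∧
          Heisenberg.perimeter (Heisenberg.subgraph f) U < ⊤ ∧
          Heisenberg.IsPerimeterMinimizer (Heisenberg.subgraph f) U) := by
  open Heisenberg in
  refine ⟨⟨contDiffOn_nu, fun p hp => hdiv_nu hp,
    isDivFreeOn_of_hdiv_eq_zero isOpen_offAxis contDiffOn_nu fun p hp => hdiv_nu hp⟩,
    fun a f hf => ?_⟩
  have hpos := smoothNormal_subgraph hf.1 hf.2.1 (σ := 1) (Or.inl rfl)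
  have hneg := smoothNormal_subgraph hf.1 hf.2.1 (σ := -1) (Or.inr rfl)
  rw [← hf.subgraph_eq] at hpos hneg
  rw [one_smul] at hpos
  rw [neg_one_smul] at hneg
  have hside : side 1 = {p : Pt | 0 < p.2.1} := by ext p; simp [side]
  have hside' : side (-1) = {p : Pt | p.2.1 < 0} := by ext p; simp [side]
  refine ⟨fun p hp => ?_, hside ▸ hpos.isCalibration, hside' ▸ hneg.isCalibration, fun p hp => ?_⟩
  · rcases (hf.snd_ne_zero hp).lt_or_gt with h | h
    · exact ⟨side (-1), isOpen_side _, by simpa [side] using h, side_subset_offAxis _,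
        Or.inr hneg.isCalibration⟩
    · exact ⟨side 1, isOpen_side _, by simpa [side] using h, side_subset_offAxis _,
        Or.inl hpos.isCalibration⟩
  · rcases (hf.snd_ne_zero hp).lt_or_gt with h | h
    · obtain ⟨V, hV, hpV, hVU, hmin⟩ :=
        hneg.exists_isPerimeterMinimizer (p := p) (by simpa [side] using h)
      exact ⟨V, hV, hpV, hVU.trans (side_subset_offAxis _), hmin⟩
    · obtain ⟨V, hV, hpV, hVU, hmin⟩ :=
        hpos.exists_isPerimeterMinimizer (p := p) (by simpa [side] using h)
      exact ⟨V, hV, hpV, hVU.trans (side_subset_offAxis _), hmin⟩
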